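/- Let $E=(E^0,E^1,r,s)$ be a finite directed multigraph without sinks, and let $C^*(E)$ be its graph $C^*$-algebra, i.e. the universal $C^*$-algebra generated by mutually orthogonal projections $P_v$ ($v\in E^0$) and partial isometries $S_e$ ($e\in E^1$) with $S_e^*S_e=P_{r(e)}$, $S_e^*S_f=0$ for $e\neq f$, $S_eS_e^*\le P_{s(e)}$, and $P_v=\sum_{s(e)=v}S_eS_e^*$ whenever $v$ emits a nonzero finite number of edges. Let $E^n$ be the set of paths $\mu=\mu_1\cdots\mu_n$ of length $n$ in $E$ (with $r(\mu_i)=s(\mu_{i+1})$, and $E^0$ the vertices), and put $S_\mu=S_{\mu_1}\cdots S_{\mu_n}$, with $S_v=P_v$ for $v\in E^0$. Let $k\ge 1$ and let $\tau$ be an endpoint-fixing permutation of $E^k$, i.e. one that maps the set of paths of length $k$ from $u$ to $v$ onto itself for all $u,v\in E^0$. Let $U_\tau=\sum_{\alpha\in E^k}S_{\tau(\alpha)}S_\alpha^*$, and let $\lambda_\tau$ be the endomorphism of $C^*(E)$ with $\lambda_\tau(P_v)=P_v$ and $\lambda_\tau(S_e)=U_\tau S_e$. Let $E_\tau$ be the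 graph with vertex set $E^{k-1}$ and edge set $E^k$ in which $\mu\in E^k$ has source $s_\tau(\mu)=\tau(\mu)_1\cdots\tau(\mu)_{k-1}$ and range $r_\tau(\mu)=\mu_2\cdots\mu_k$ (for $k=1$ these are the vertices $s(\tau(\mu))$ and $r(\mu)$), with edge labels $\mathcal L_1(\mu)=\mu_1$ and $\mathcal L_2(\mu)=\tau(\mu)_k$. The labels extend to paths in $E_\tau$ edge by edge, and $\mathcal L_1(A),\mathcal L_2(A)\in E^l$ for every path $A$ of length $l$ in $E_\tau$; for a path of length $0$, i.e. a vertex $\beta\in E^{k-1}$ of $E_\tau$, put $\mathcal L_1(\beta)=s(\beta)$ and $\mathcal L_2(\beta)=r(\beta)$. Then for every $l\ge 0$ and every $\gamma\in E^l$, $$\lambda_\tau(S_\gamma)=\sum_{A\in E_\tau^l,\ \mathcal L_1(A)=\gamma} S_{s_\tau(A)}\,S_{\mathcal L_2(A)}\,S_{r_\tau(A)}^*,$$ where $s_\tau(A),r_\tau(A)\in E^{k-1}$ denote the source and the range of the path $A$. -/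

import Mathlib

universe u

noncomputable section

namespace PermEnd

/-! ### Directed multigraphs and paths -/

/-- A directed multigraph with vertex set `V` and edge set `E`
(multiple edges and loops are allowed). -/
structure Multigraph (V E : Type*) where
  /-- source map -/
  s : E → V
  /-- range map -/
  r : E → V

/-- Paths of length `n`: edges `e₁, …, eₙ` together with the visited vertices `v₁, …, vₙ₊₁`, where
`eᵢ` runs from `vᵢ` to `vᵢ₊₁`. A path of length `0` is a vertex, and for `n ≥ 1` the vertices
are determined by the edges. -/
@[ext]
structure Multigraph.Path {V E : Type*} (G : Multigraph V E) (n : ℕ) where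
  /-- the visited vertices -/
  vert : Fin (n + 1) → V
  /-- the edges -/
  edge : Fin n → E
  s_edge : ∀ i, G.s (edge i) = vert i.castSucc
  r_edge : ∀ i, G.r (edge i) = vert i.succ

namespace Multigraph

section Path

variable {V E : Type*} {G : Multigraph V E}

/-- The source of a path. -/
def Path.source {n : ℕ} (p : G.Path n) : V := p.vert 0

/-- The range of a path. -/
def Path.range {n : ℕ} (p : G.Path n) : V := p.vert (Fin.last n)

/-- `μ₁ ⋯ μₙ₊₁ ↦ μ₂ ⋯ μₙ₊₁` (a single edge goes to its range). -/
def Path.tail {n : ℕ} (p : G.Path (n + 1)) : G.Path n where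
  vert i := p.vert i.succ
  edge i := p.edge i.succ
  s_edge i := by rw [p.s_edge]; rfl
  r_edge i := p.r_edge i.succ

/-- `μ₁ ⋯ μₙ₊₁ ↦ μ₁ ⋯ μₙ` (a single edge goes to its source). -/
def Path.init {n : ℕ} (p : G.Path (n + 1)) : G.Path n where
  vert i := p.vert i.castSucc
  edge i := p.edge i.castSucc
  s_edge i := p.s_edge i.castSucc
  r_edge i := by rw [p.r_edge]; rfl

/-- A vertex as a path of length `0`. -/
def vertexPath (G : Multigraph V E) (v : V) : G.Path 0 where
  vert _ := v
  edge i := i.elim0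
  s_edge i := i.elim0
  r_edge i := i.elim0

/-- An edge as a path of length `1`. -/
def edgePath (G : Multigraph V E) (e : E) : G.Path 1 where
  vert := ![G.s e, G.r e]
  edge _ := e
  s_edge i := by fin_cases i; rfl
  r_edge i := by fin_cases i; rfl

/-- A finite graph has finitely many paths of length `n`. -/
instance [Finite V] [Finite E] (n : ℕ) : Fintype (G.Path n) :=
  have : Finite (G.Path n) := Finite.of_injective
    (fun p : G.Path n => (p.vert, p.edge)) (fun p q h => by
      simp only [Prod.mk.injEq] at h
      exact Path.ext h.1 h.2)
  Fintype.ofFinite _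

/-- No vertex is a sink, i.e. every vertex emits an edge. -/
def NoSinks (G : Multigraph V E) : Prop := ∀ v, ∃ e, G.s e = v

end Path

/-! ### Graph families and the graph C⋆-algebra -/

/-- A family `{P_v}` of mutually orthogonal projections and `{S_e}` of partial isometries in a
C⋆-algebra `A` that satisfies the relations of the graph `G`. -/
@[ext]
structure Family {V E : Type*} (G : Multigraph V E) (A : Type*) [NonUnitalCStarAlgebra A] where
  P : V → A
  S : E → A
  proj : ∀ v, IsStarProjection (P v)
  orth : ∀ v w, v ≠ w → P v * P w = 0
  partialIsometry : ∀ e, S e * star (S e) * S e = S e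
  star_mul_self : ∀ e, star (S e) * S e = P (G.r e)
  star_mul_of_ne : ∀ e f, e ≠ f → star (S e) * S f = 0
  /-- the relation `S_e S_e⋆ ≤ P_{s(e)}` between projections -/
  range_le : ∀ e, P (G.s e) * (S e * star (S e)) = S e * star (S e)
  /-- `P_v = ∑_{s(e) = v} S_e S_e⋆` if `v` emits a nonzero finite number of edges -/
  sum_range : ∀ v, ∀ h : {e | G.s e = v}.Finite, {e | G.s e = v}.Nonempty →
    P v = ∑ e ∈ h.toFinset, S e * star (S e)

variable {V E : Type u}

/-- The formal ⋆-polynomials without constant term in the symbols `P_v` and `S_e`. -/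
inductive Poly (V E : Type u) : Type u
  | p : V → Poly V E
  | s : E → Poly V E
  | zero : Poly V E
  | add : Poly V E → Poly V E → Poly V E
  | neg : Poly V E → Poly V E
  | smul : ℂ → Poly V E → Poly V E
  | mul : Poly V E → Poly V E → Poly V E
  | adj : Poly V E → Poly V E

/-- Evaluation of a ⋆-polynomial at a family. -/
def Family.eval {G : Multigraph V E} {A : Type*} [NonUnitalCStarAlgebra A] (φ : G.Family A) :
    Poly V E → A
  | .p v => φ.P v
  | .s e => φ.S e
  | .zero => 0
  | .add a b => φ.eval a + φ.eval b
  | .neg a => -φ.eval a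
  | .smul c a => c • φ.eval a
  | .mul a b => φ.eval a * φ.eval b
  | .adj a => star (φ.eval a)

/-- A C⋆-algebra with a family for `G` in it. -/
structure Rep (G : Multigraph V E) where
  A : Type u
  [inst : NonUnitalCStarAlgebra A]
  fam : G.Family A

attribute [instance] Rep.inst

/-- Two ⋆-polynomials are identified when they agree on all families for `G` in C⋆-algebras. -/
def polySetoid (G : Multigraph V E) : Setoid (Poly V E) where
  r a b := ∀ π : G.Rep, π.fam.eval a = π.fam.eval b
  iseqv := ⟨fun _ _ => rfl, fun h π => (h π).symm, fun h k π => (h π).trans (k π)⟩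

/-- The ⋆-algebra of ⋆-polynomials in `P_v`, `S_e` modulo all relations that hold for every family.
Its completion in the universal C⋆-norm is the graph C⋆-algebra. -/
def Pre (G : Multigraph V E) : Type u := Quotient G.polySetoid

namespace Pre

variable {G : Multigraph V E}

/-- The class of a ⋆-polynomial. -/
def mk (G : Multigraph V E) (a : Poly V E) : G.Pre := Quotient.mk G.polySetoid a

@[elab_as_elim]
theorem mk_induction {p : G.Pre → Prop} (a : G.Pre) (h : ∀ x, p (mk G x)) : p a :=
  Quotient.inductionOn a h

/-- Evaluation on classes of ⋆-polynomials. -/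
def eval (π : G.Rep) (a : G.Pre) : π.A :=
  Quotient.lift (s := G.polySetoid) π.fam.eval (fun _ _ h => h π) a

theorem ext {a b : G.Pre} (h : ∀ π : G.Rep, eval π a = eval π b) : a = b := by
  induction a using mk_induction
  induction b using mk_induction
  exact Quotient.sound h

theorem eval_mk (π : G.Rep) (x : Poly V E) : eval π (mk G x) = π.fam.eval x := rfl


instance : Zero G.Pre := ⟨mk G .zero⟩
instance : Add G.Pre := ⟨Quotient.map₂ .add fun _ _ h _ _ k π => congrArg₂ (· + ·) (h π) (k π)⟩
instance : Neg G.Pre := ⟨Quotient.map .neg fun _ _ h π => congrArg Neg.neg (h π)⟩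
instance : SMul ℂ G.Pre := ⟨fun c => Quotient.map (.smul c) fun _ _ h π => congrArg (fun x => c • x) (h π)⟩
instance : Mul G.Pre := ⟨Quotient.map₂ .mul fun _ _ h _ _ k π => congrArg₂ (· * ·) (h π) (k π)⟩
instance : Star G.Pre := ⟨Quotient.map .adj fun _ _ h π => congrArg star (h π)⟩

section
variable (π : G.Rep)

@[simp] theorem eval_zero : eval π 0 = 0 := rfl
@[simp] theorem eval_add (a b : G.Pre) : eval π (a + b) = eval π a + eval π b := by
  induction a using mk_induction; induction b using mk_induction; rfl
@[simp] theorem eval_neg (a : G.Pre) : eval π (-a) = -eval π a := by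
  induction a using mk_induction; rfl
@[simp] theorem eval_smul (c : ℂ) (a : G.Pre) : eval π (c • a) = c • eval π a := by
  induction a using mk_induction; rfl
@[simp] theorem eval_mul (a b : G.Pre) : eval π (a * b) = eval π a * eval π b := by
  induction a using mk_induction; induction b using mk_induction; rfl
@[simp] theorem eval_star (a : G.Pre) : eval π (star a) = star (eval π a) := by
  induction a using mk_induction; rfl
end

theorem mk_add (a b : Poly V E) : mk G (a.add b) = mk G a + mk G b := rfl
theorem mk_neg (a : Poly V E) : mk G a.neg = -mk G a := rfl
theorem mk_smul (c : ℂ) (a : Poly V E) : mk G (.smul c a) = c • mk G a := rfl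
theorem mk_mul (a b : Poly V E) : mk G (a.mul b) = mk G a * mk G b := rfl
theorem mk_adj (a : Poly V E) : mk G a.adj = star (mk G a) := rfl

instance : NonUnitalRing G.Pre where
  add_assoc a b c := ext fun π => by simp [add_assoc]
  zero_add a := ext fun π => by simp
  add_zero a := ext fun π => by simp
  nsmul := nsmulRec
  zsmul := zsmulRec
  neg_add_cancel a := ext fun π => by simp
  add_comm a b := ext fun π => by simp [add_comm]
  left_distrib a b c := ext fun π => by simp [mul_add]
  right_distrib a b c := ext fun π => by simp [add_mul]
  zero_mul a := ext fun π => by simp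
  mul_zero a := ext fun π => by simp
  mul_assoc a b c := ext fun π => by simp [mul_assoc]

instance : Module ℂ G.Pre where
  one_smul a := ext fun π => by simp
  mul_smul c d a := ext fun π => by simp [mul_smul]
  smul_zero c := ext fun π => by simp
  smul_add c a b := ext fun π => by simp
  add_smul c d a := ext fun π => by simp [add_smul]
  zero_smul a := ext fun π => by simp

instance : IsScalarTower ℂ G.Pre G.Pre := ⟨fun c a b => ext fun π => by simp [smul_mul_assoc]⟩
instance : SMulCommClass ℂ G.Pre G.Pre := ⟨fun c a b => ext fun π => by simp [mul_smul_comm]⟩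

instance : StarRing G.Pre where
  star_involutive a := ext fun π => by simp
  star_mul a b := ext fun π => by simp
  star_add a b := ext fun π => by simp

instance : StarModule ℂ G.Pre := ⟨fun c a => ext fun π => by simp⟩

theorem norm_le_one_of_proj {A : Type*} [NonUnitalCStarAlgebra A] {p : A}
    (hp : IsStarProjection p) : ‖p‖ ≤ 1 := by
  have h : ‖p‖ * ‖p‖ = ‖p‖ := by
    rw [← CStarRing.norm_star_mul_self, hp.isSelfAdjoint.star_eq, hp.isIdempotentElem.eq]
  by_contra hc
  nlinarith

theorem norm_S_le_one {A : Type*} [NonUnitalCStarAlgebra A] (φ : G.Family A) (e : E) :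
    ‖φ.S e‖ ≤ 1 := by
  have h : ‖φ.S e‖ * ‖φ.S e‖ ≤ 1 := by
    rw [← CStarRing.norm_star_mul_self, φ.star_mul_self]
    exact norm_le_one_of_proj (φ.proj _)
  nlinarith [norm_nonneg (φ.S e)]

/-- The values of a ⋆-polynomial on all families are uniformly bounded. -/
theorem bdd (a : G.Pre) : BddAbove (Set.range fun π : G.Rep => ‖eval π a‖) := by
  suffices h : ∃ C : ℝ, ∀ π : G.Rep, ‖eval π a‖ ≤ C by
    obtain ⟨C, hC⟩ := h
    exact ⟨C, by rintro _ ⟨π, rfl⟩; exact hC π⟩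
  induction a using Pre.mk_induction with | _ a =>
  change ∃ C : ℝ, ∀ π : G.Rep, ‖π.fam.eval a‖ ≤ C
  induction a with
  | p v => exact ⟨1, fun π => norm_le_one_of_proj (π.fam.proj v)⟩
  | s e => exact ⟨1, fun π => norm_S_le_one π.fam e⟩
  | zero => exact ⟨0, fun π => by simp [Family.eval]⟩
  | add a b ha hb =>
    obtain ⟨C, hC⟩ := ha
    obtain ⟨D, hD⟩ := hb
    exact ⟨C + D, fun π => (norm_add_le _ _).trans (add_le_add (hC π) (hD π))⟩
  | neg a ha =>
    obtain ⟨C, hC⟩ := ha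
    exact ⟨C, fun π => by simpa [Family.eval] using hC π⟩
  | smul c a ha =>
    obtain ⟨C, hC⟩ := ha
    exact ⟨‖c‖ * C, fun π => by
      simpa [Family.eval, norm_smul] using mul_le_mul_of_nonneg_left (hC π) (norm_nonneg c)⟩
  | mul a b ha hb =>
    obtain ⟨C, hC⟩ := ha
    obtain ⟨D, hD⟩ := hb
    exact ⟨C * D, fun π => (norm_mul_le _ _).trans
      (mul_le_mul (hC π) (hD π) (norm_nonneg _) ((norm_nonneg _).trans (hC π)))⟩
  | adj a ha =>
    obtain ⟨C, hC⟩ := ha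
    exact ⟨C, fun π => by simpa [Family.eval] using hC π⟩

/-- The universal C⋆-norm: the supremum over all families for `G` in C⋆-algebras. -/
def unorm (a : G.Pre) : ℝ := ⨆ π : G.Rep, ‖eval π a‖

theorem unorm_nonneg (a : G.Pre) : 0 ≤ unorm a := Real.iSup_nonneg fun _ => norm_nonneg _

theorem le_unorm (π : G.Rep) (a : G.Pre) : ‖eval π a‖ ≤ unorm a := le_ciSup (bdd a) π

instance : NormedAddCommGroup G.Pre :=
  AddGroupNorm.toNormedAddCommGroup
    { toFun := unorm
      map_zero' := by simp [unorm]
      add_le' := fun a b => Real.iSup_le (fun π => by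
        rw [eval_add]
        exact (norm_add_le _ _).trans (add_le_add (le_unorm π a) (le_unorm π b)))
        (add_nonneg (unorm_nonneg a) (unorm_nonneg b))
      neg' := fun a => by simp [unorm]
      eq_zero_of_map_eq_zero' := fun a h => ext fun π => by
        simpa using (le_unorm π a).trans h.le }

theorem norm_def (a : G.Pre) : ‖a‖ = ⨆ π : G.Rep, ‖eval π a‖ := rfl

theorem norm_eval_le (π : G.Rep) (a : G.Pre) : ‖eval π a‖ ≤ ‖a‖ := le_unorm π a

instance : NonUnitalNormedRing G.Pre where
  __ := (inferInstance : NonUnitalRing G.Pre)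
  __ := (inferInstance : NormedAddCommGroup G.Pre)
  norm_mul_le a b := Real.iSup_le (fun π => by
    rw [eval_mul]
    exact (norm_mul_le _ _).trans (mul_le_mul (norm_eval_le π a) (norm_eval_le π b)
      (norm_nonneg _) (norm_nonneg _))) (mul_nonneg (norm_nonneg a) (norm_nonneg b))

instance : NormedSpace ℂ G.Pre where
  norm_smul_le c a := Real.iSup_le (fun π => by
    rw [eval_smul, norm_smul]
    exact mul_le_mul_of_nonneg_left (norm_eval_le π a) (norm_nonneg c))
    (mul_nonneg (norm_nonneg c) (norm_nonneg a))

instance : CStarRing G.Pre where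
  norm_mul_self_le a := by
    have h : ‖a‖ ≤ √‖star a * a‖ := Real.iSup_le (fun π => by
      apply Real.le_sqrt_of_sq_le
      rw [sq, ← CStarRing.norm_star_mul_self, ← eval_star, ← eval_mul]
      exact norm_eval_le π _) (Real.sqrt_nonneg _)
    calc ‖a‖ * ‖a‖ ≤ √‖star a * a‖ * √‖star a * a‖ :=
          mul_le_mul h h (norm_nonneg _) (Real.sqrt_nonneg _)
      _ = ‖star a * a‖ := Real.mul_self_sqrt (norm_nonneg _)

end Pre

/-- The graph C⋆-algebra `C⋆(G)`: the completion of the ⋆-algebra of ⋆-polynomials in `P_v`, `S_e`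
in the universal C⋆-norm. -/
def CStarAlg (G : Multigraph V E) : Type u := UniformSpace.Completion G.Pre

namespace CStarAlg

open UniformSpace

variable {G : Multigraph V E}

instance : NormedAddCommGroup G.CStarAlg := inferInstanceAs (NormedAddCommGroup (Completion G.Pre))
instance : NormedSpace ℂ G.CStarAlg := inferInstanceAs (NormedSpace ℂ (Completion G.Pre))
instance : CompleteSpace G.CStarAlg := inferInstanceAs (CompleteSpace (Completion G.Pre))

theorem continuous_smul' (c : ℂ) : Continuous fun x : G.CStarAlg => c • x :=
  continuous_const_smul c

/-- The canonical map into the completion. -/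
def ofPre (a : G.Pre) : G.CStarAlg := (a : Completion G.Pre)

theorem continuous_ofPre : Continuous (ofPre : G.Pre → G.CStarAlg) := Completion.continuous_coe _

theorem isDenseInducing_ofPre : IsDenseInducing (ofPre : G.Pre → G.CStarAlg) :=
  Completion.isDenseInducing_coe

theorem ofPre_zero : (ofPre 0 : G.CStarAlg) = 0 := rfl
theorem ofPre_add (a b : G.Pre) : ofPre (a + b) = ofPre a + ofPre b := Completion.coe_add a b
theorem ofPre_smul (c : ℂ) (a : G.Pre) : ofPre (c • a) = c • ofPre a := Completion.coe_smul c a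
theorem norm_ofPre (a : G.Pre) : ‖ofPre a‖ = ‖a‖ := Completion.norm_coe a

@[elab_as_elim]
theorem induction_on {p : G.CStarAlg → Prop} (x : G.CStarAlg) (hp : IsClosed {x | p x})
    (ih : ∀ a, p (ofPre a)) : p x := Completion.induction_on x hp ih

@[elab_as_elim]
theorem induction_on₂ {p : G.CStarAlg → G.CStarAlg → Prop} (x y : G.CStarAlg)
    (hp : IsClosed {x : G.CStarAlg × G.CStarAlg | p x.1 x.2})
    (ih : ∀ a b, p (ofPre a) (ofPre b)) : p x y := Completion.induction_on₂ x y hp ih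

@[elab_as_elim]
theorem induction_on₃ {p : G.CStarAlg → G.CStarAlg → G.CStarAlg → Prop} (x y z : G.CStarAlg)
    (hp : IsClosed {x : G.CStarAlg × G.CStarAlg × G.CStarAlg | p x.1 x.2.1 x.2.2})
    (ih : ∀ a b c, p (ofPre a) (ofPre b) (ofPre c)) : p x y z :=
  Completion.induction_on₃ x y z hp ih

/-- The continuous extension of the multiplication. -/
instance : Mul G.CStarAlg :=
  ⟨Function.curry <| (isDenseInducing_ofPre.prodMap isDenseInducing_ofPre).extend
    (ofPre ∘ Function.uncurry (· * ·))⟩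

theorem ofPre_mul (a b : G.Pre) : ofPre (a * b) = ofPre a * ofPre b :=
  ((isDenseInducing_ofPre.prodMap isDenseInducing_ofPre).extend_eq
    (continuous_ofPre.comp continuous_mul) (a, b)).symm

instance : ContinuousMul G.CStarAlg where
  continuous_mul := by
    let i : G.Pre →+ G.CStarAlg := ⟨⟨ofPre, ofPre_zero⟩, ofPre_add⟩
    let m := (AddMonoidHom.mul : G.Pre →+ G.Pre →+ G.Pre).compr₂ i
    have : Continuous fun p : G.Pre × G.Pre => m p.1 p.2 := continuous_ofPre.comp continuous_mul
    have di : IsDenseInducing i := isDenseInducing_ofPre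
    exact (di.extend_Z_bilin di this :)

/-- The continuous extension of the involution. -/
instance : Star G.CStarAlg := ⟨Completion.map (star : G.Pre → G.Pre)⟩

theorem uniformContinuous_star : UniformContinuous (star : G.Pre → G.Pre) :=
  (starₗᵢ ℂ : G.Pre ≃ₗᵢ⋆[ℂ] G.Pre).isometry.uniformContinuous

theorem ofPre_star (a : G.Pre) : ofPre (star a) = star (ofPre a) :=
  (Completion.map_coe uniformContinuous_star a).symm

instance : ContinuousStar G.CStarAlg := ⟨Completion.continuous_map⟩

instance : NonUnitalRing G.CStarAlg where
  __ := (inferInstance : AddCommGroup G.CStarAlg)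
  zero_mul x := by
    induction x using induction_on with
    | hp => exact isClosed_eq (by fun_prop) (by fun_prop)
    | ih a => rw [← ofPre_zero, ← ofPre_mul, zero_mul]
  mul_zero x := by
    induction x using induction_on with
    | hp => exact isClosed_eq (by fun_prop) (by fun_prop)
    | ih a => rw [← ofPre_zero, ← ofPre_mul, mul_zero]
  mul_assoc x y z := by
    induction x, y, z using induction_on₃ with
    | hp => exact isClosed_eq (by fun_prop) (by fun_prop)
    | ih a b c => simp only [← ofPre_mul, mul_assoc]
  left_distrib x y z := by
    induction x, y, z using induction_on₃ with
    | hp => exact isClosed_eq (by fun_prop) (by fun_prop)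
    | ih a b c => simp only [← ofPre_mul, ← ofPre_add, mul_add]
  right_distrib x y z := by
    induction x, y, z using induction_on₃ with
    | hp => exact isClosed_eq (by fun_prop) (by fun_prop)
    | ih a b c => simp only [← ofPre_mul, ← ofPre_add, add_mul]

instance : NonUnitalNormedRing G.CStarAlg where
  __ := (inferInstance : NonUnitalRing G.CStarAlg)
  __ := (inferInstance : NormedAddCommGroup G.CStarAlg)
  norm_mul_le x y := by
    induction x, y using induction_on₂ with
    | hp => exact isClosed_le (by fun_prop) (by fun_prop)
    | ih a b => simpa only [← ofPre_mul, norm_ofPre] using norm_mul_le a b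

instance : StarRing G.CStarAlg where
  star_involutive x := by
    induction x using induction_on with
    | hp => exact isClosed_eq (by fun_prop) (by fun_prop)
    | ih a => simp only [← ofPre_star, star_star]
  star_mul x y := by
    induction x, y using induction_on₂ with
    | hp => exact isClosed_eq (by fun_prop) (by fun_prop)
    | ih a b => simp only [← ofPre_mul, ← ofPre_star, star_mul]
  star_add x y := by
    induction x, y using induction_on₂ with
    | hp => exact isClosed_eq (by fun_prop) (by fun_prop)
    | ih a b => simp only [← ofPre_add, ← ofPre_star, star_add]

instance : CStarRing G.CStarAlg where
  norm_mul_self_le x := by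
    induction x using induction_on with
    | hp => exact isClosed_le (by fun_prop) (by fun_prop)
    | ih a => simpa only [← ofPre_mul, ← ofPre_star, norm_ofPre] using CStarRing.norm_mul_self_le a

instance : IsScalarTower ℂ G.CStarAlg G.CStarAlg where
  smul_assoc c x y := by
    induction x, y using induction_on₂ with
    | hp =>
      exact isClosed_eq
        (((continuous_smul' c).comp continuous_fst).mul continuous_snd)
        ((continuous_smul' c).comp (continuous_fst.mul continuous_snd))
    | ih a b => simp only [smul_eq_mul, ← ofPre_mul, ← ofPre_smul, smul_mul_assoc]

instance : SMulCommClass ℂ G.CStarAlg G.CStarAlg where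
  smul_comm c x y := by
    induction x, y using induction_on₂ with
    | hp =>
      exact isClosed_eq
        ((continuous_smul' c).comp (continuous_fst.mul continuous_snd))
        (continuous_fst.mul ((continuous_smul' c).comp continuous_snd))
    | ih a b => simp only [smul_eq_mul, ← ofPre_mul, ← ofPre_smul, mul_smul_comm]

instance : StarModule ℂ G.CStarAlg where
  star_smul c x := by
    induction x using induction_on with
    | hp =>
      exact isClosed_eq
        ((continuous_smul' c).star)
        ((continuous_smul' (star c)).comp continuous_star)
    | ih a => simp only [← ofPre_smul, ← ofPre_star, star_smul]

instance : NonUnitalCStarAlgebra G.CStarAlg where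


/-- The generating projections of `C⋆(G)`. -/
def P (G : Multigraph V E) (v : V) : G.CStarAlg := ofPre (Pre.mk G (.p v))

/-- The generating partial isometries of `C⋆(G)`. -/
def S (G : Multigraph V E) (e : E) : G.CStarAlg := ofPre (Pre.mk G (.s e))

theorem ofPre_sum {ι : Type*} (t : Finset ι) (f : ι → G.Pre) :
    ofPre (∑ i ∈ t, f i) = ∑ i ∈ t, ofPre (f i) :=
  map_sum (⟨⟨ofPre, ofPre_zero⟩, ofPre_add⟩ : G.Pre →+ G.CStarAlg) f t

theorem eval_sum (π : G.Rep) {ι : Type*} (t : Finset ι) (f : ι → G.Pre) :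
    Pre.eval π (∑ i ∈ t, f i) = ∑ i ∈ t, Pre.eval π (f i) :=
  map_sum (⟨⟨Pre.eval π, Pre.eval_zero π⟩, Pre.eval_add π⟩ : G.Pre →+ π.A) f t

theorem eval_p (π : G.Rep) (v : V) :
    Pre.eval π (Pre.mk G (.p v)) = π.fam.P v := rfl

theorem eval_s (π : G.Rep) (e : E) :
    Pre.eval π (Pre.mk G (.s e)) = π.fam.S e := rfl

/-- The universal family in `C⋆(G)`. -/
def univ (G : Multigraph V E) : G.Family G.CStarAlg where
  P := P G
  S := S G
  proj v := by
    constructor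
    · rw [IsIdempotentElem, P, ← ofPre_mul]
      refine congrArg ofPre (Pre.ext fun π => ?_)
      rw [Pre.eval_mul, eval_p, (π.fam.proj v).isIdempotentElem.eq]
    · rw [IsSelfAdjoint, P, ← ofPre_star]
      refine congrArg ofPre (Pre.ext fun π => ?_)
      rw [Pre.eval_star, eval_p, (π.fam.proj v).isSelfAdjoint.star_eq]
  orth v w h := by
    rw [P, P, ← ofPre_mul, ← ofPre_zero]
    refine congrArg ofPre (Pre.ext fun π => ?_)
    rw [Pre.eval_mul, eval_p, eval_p, π.fam.orth v w h, Pre.eval_zero]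
  partialIsometry e := by
    rw [S, ← ofPre_star, ← ofPre_mul, ← ofPre_mul]
    refine congrArg ofPre (Pre.ext fun π => ?_)
    rw [Pre.eval_mul, Pre.eval_mul, Pre.eval_star, eval_s, π.fam.partialIsometry]
  star_mul_self e := by
    rw [S, P, ← ofPre_star, ← ofPre_mul]
    refine congrArg ofPre (Pre.ext fun π => ?_)
    rw [Pre.eval_mul, Pre.eval_star, eval_s, eval_p, π.fam.star_mul_self]
  star_mul_of_ne e f h := by
    rw [S, S, ← ofPre_star, ← ofPre_mul, ← ofPre_zero]
    refine congrArg ofPre (Pre.ext fun π => ?_)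
    rw [Pre.eval_mul, Pre.eval_star, eval_s, eval_s, π.fam.star_mul_of_ne e f h, Pre.eval_zero]
  range_le e := by
    rw [S, P, ← ofPre_star, ← ofPre_mul, ← ofPre_mul]
    refine congrArg ofPre (Pre.ext fun π => ?_)
    rw [Pre.eval_mul, Pre.eval_mul, Pre.eval_star, eval_s, eval_p, π.fam.range_le]
  sum_range v h hne := by
    simp only [S, P, ← ofPre_star, ← ofPre_mul]
    rw [← ofPre_sum]
    refine congrArg ofPre (Pre.ext fun π => ?_)
    simp only [eval_sum, Pre.eval_mul, Pre.eval_star, eval_s, eval_p]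
    exact π.fam.sum_range v h hne

section lift

variable {A : Type u} [NonUnitalCStarAlgebra A]

theorem uniformContinuous_eval (π : G.Rep) : UniformContinuous (Pre.eval π) :=
  (AddMonoidHomClass.lipschitz_of_bound
    (⟨⟨Pre.eval π, Pre.eval_zero π⟩, Pre.eval_add π⟩ : G.Pre →+ π.A) 1
    (fun a => by simpa using Pre.norm_eval_le π a)).uniformContinuous

/-- The underlying map of `lift`. -/
def liftFun (φ : G.Family A) : G.CStarAlg → A := Completion.extension (Pre.eval ⟨A, φ⟩)

theorem continuous_liftFun (φ : G.Family A) : Continuous (liftFun φ) :=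
  Completion.continuous_extension

theorem liftFun_ofPre (φ : G.Family A) (a : G.Pre) :
    liftFun φ (ofPre a) = Pre.eval ⟨A, φ⟩ a :=
  Completion.extension_coe (uniformContinuous_eval ⟨A, φ⟩) a

/-- The universal property of `C⋆(G)`: a family for `G` in a C⋆-algebra `A` induces a
⋆-homomorphism `C⋆(G) → A` that maps the generators to the family. -/
def lift (φ : G.Family A) : G.CStarAlg →⋆ₙₐ[ℂ] A where
  toFun := liftFun φ
  map_smul' c x := by
    have h := continuous_liftFun φ
    induction x using induction_on with
    | hp => exact isClosed_eq (h.comp (continuous_smul' c)) (h.const_smul c)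
    | ih a => simp [← ofPre_smul, liftFun_ofPre]
  map_zero' := by rw [← ofPre_zero, liftFun_ofPre, Pre.eval_zero]
  map_add' x y := by
    have h := continuous_liftFun φ
    induction x, y using induction_on₂ with
    | hp => exact isClosed_eq (by fun_prop) (by fun_prop)
    | ih a b => simp only [← ofPre_add, liftFun_ofPre, Pre.eval_add]
  map_mul' x y := by
    have h := continuous_liftFun φ
    induction x, y using induction_on₂ with
    | hp => exact isClosed_eq (by fun_prop) (by fun_prop)
    | ih a b => simp only [← ofPre_mul, liftFun_ofPre, Pre.eval_mul]
  map_star' x := by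
    have h := continuous_liftFun φ
    induction x using induction_on with
    | hp => exact isClosed_eq (by fun_prop) (by fun_prop)
    | ih a => simp only [← ofPre_star, liftFun_ofPre, Pre.eval_star]

theorem lift_P (φ : G.Family A) (v : V) : lift φ (P G v) = φ.P v := liftFun_ofPre φ _

theorem lift_S (φ : G.Family A) (e : E) : lift φ (S G e) = φ.S e := liftFun_ofPre φ _

/-- Uniqueness in the universal property: a ⋆-homomorphism on `C⋆(G)` is determined by its values
on the generators. -/
theorem hom_ext {f g : G.CStarAlg →⋆ₙₐ[ℂ] A} (hP : ∀ v, f (P G v) = g (P G v))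
    (hS : ∀ e, f (S G e) = g (S G e)) : f = g := by
  ext x
  have hf : Continuous f := (AddMonoidHomClass.lipschitz_of_bound f 1 fun a => by
    simpa using NonUnitalStarAlgHom.norm_apply_le f a).continuous
  have hg : Continuous g := (AddMonoidHomClass.lipschitz_of_bound g 1 fun a => by
    simpa using NonUnitalStarAlgHom.norm_apply_le g a).continuous
  induction x using induction_on with
  | hp => exact isClosed_eq hf hg
  | ih a =>
    induction a using Pre.mk_induction with | _ a =>
    induction a with
    | p v => exact hP v
    | s e => exact hS e
    | zero => exact (map_zero f).trans (map_zero g).symm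
    | add a b ha hb =>
      rw [Pre.mk_add, ofPre_add, map_add, map_add, ha, hb]
    | neg a ha =>
      rw [Pre.mk_neg, show ofPre (-Pre.mk G a) = -ofPre (Pre.mk G a) from
        Completion.coe_neg _, map_neg, map_neg, ha]
    | smul c a ha =>
      rw [Pre.mk_smul, ofPre_smul, map_smul, map_smul, ha]
    | mul a b ha hb =>
      rw [Pre.mk_mul, ofPre_mul, map_mul, map_mul, ha, hb]
    | adj a ha =>
      rw [Pre.mk_adj, ofPre_star, map_star, map_star, ha]

end lift

end CStarAlg

/-! ### Path elements, and the unitary of an endpoint-fixing permutation of paths -/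

section Endpoint

variable {V E : Type*} {G : Multigraph V E}

/-- A permutation `τ` of the paths of length `k` is endpoint-fixing if it maps
`{α | source u, range v}` onto itself for all vertices `u`, `v`. -/
def EndpointFixing {k : ℕ} (τ : Equiv.Perm (G.Path k)) : Prop :=
  ∀ u v, τ '' {α | α.source = u ∧ α.range = v} = {α | α.source = u ∧ α.range = v}

theorem EndpointFixing.apply {k : ℕ} {τ : Equiv.Perm (G.Path k)} (h : EndpointFixing τ)
    (α : G.Path k) : (τ α).source = α.source ∧ (τ α).range = α.range := by
  have h1 : τ α ∈ τ '' {β | β.source = α.source ∧ β.range = α.range} := ⟨α, ⟨rfl, rfl⟩, rfl⟩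
  rw [h] at h1
  exact h1

/-- The path `e q₁ ⋯ qₙ`. -/
def Path.cons {n : ℕ} (e : E) (q : G.Path n) (h : G.r e = q.source) : G.Path (n + 1) where
  vert := Fin.cons (G.s e) q.vert
  edge := Fin.cons e q.edge
  s_edge i := by
    refine Fin.cases rfl (fun i => ?_) i
    simpa [← Fin.succ_castSucc] using q.s_edge i
  r_edge i := by
    refine Fin.cases h (fun i => ?_) i
    simpa using q.r_edge i

theorem Path.ext_source {p q : G.Path 0} (h : p.source = q.source) : p = q := by
  refine Path.ext (funext fun i => ?_) (funext fun i => i.elim0)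
  rw [Fin.fin_one_eq_zero i]
  exact h

theorem Path.ext_cons {n : ℕ} {p q : G.Path (n + 1)} (he : p.edge 0 = q.edge 0)
    (ht : p.tail = q.tail) : p = q := by
  apply Path.ext
  · funext i
    refine Fin.cases ?_ (fun i => ?_) i
    · have h1 := p.s_edge 0
      have h2 := q.s_edge 0
      rw [he] at h1
      exact h1.symm.trans h2
    · exact congrFun (congrArg Path.vert ht) i
  · funext i
    exact Fin.cases he (fun i => congrFun (congrArg Path.edge ht) i) i

end Endpoint

namespace Family

variable {V E : Type*} {G : Multigraph V E} {A : Type*} [NonUnitalCStarAlgebra A] (φ : G.Family A)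

theorem S_mul_P (e : E) : φ.S e * φ.P (G.r e) = φ.S e := by
  rw [← φ.star_mul_self, ← mul_assoc, φ.partialIsometry]

theorem P_mul_S (e : E) : φ.P (G.s e) * φ.S e = φ.S e := by
  have h := congrArg (· * φ.S e) (φ.range_le e)
  simpa only [mul_assoc, φ.star_mul_self, φ.S_mul_P] using h

/-- The element `S_μ = S_{μ₁} ⋯ S_{μₙ}` of a path `μ` (and `P_v` for a vertex `v`, regarded as a path
of length `0`). The recursion ends with the projection `P_{r(μ)}`, which `S_{μₙ}` absorbs. -/
def elt : {n : ℕ} → G.Path n → A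
  | 0, p => φ.P p.source
  | _ + 1, p => φ.S (p.edge 0) * elt p.tail

theorem elt_vertexPath (v : V) : φ.elt (G.vertexPath v) = φ.P v := rfl

theorem elt_edgePath (e : E) : φ.elt (G.edgePath e) = φ.S e := φ.S_mul_P e

theorem P_source_mul_elt {n : ℕ} (p : G.Path n) : φ.P p.source * φ.elt p = φ.elt p := by
  cases n with
  | zero => exact (φ.proj _).isIdempotentElem.eq
  | succ n =>
    rw [elt, ← mul_assoc, show p.source = G.s (p.edge 0) from (p.s_edge 0).symm, φ.P_mul_S]

theorem P_mul_elt_of_ne {n : ℕ} (p : G.Path n) {v : V} (h : v ≠ p.source) :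
    φ.P v * φ.elt p = 0 := by
  rw [← φ.P_source_mul_elt, ← mul_assoc, φ.orth _ _ h, zero_mul]

theorem elt_mul_P_range {n : ℕ} (p : G.Path n) : φ.elt p * φ.P p.range = φ.elt p := by
  induction n with
  | zero => exact (φ.proj _).isIdempotentElem.eq
  | succ n ih =>
    rw [elt, mul_assoc]
    exact congrArg _ (ih p.tail)

theorem star_elt_mul_self {n : ℕ} (p : G.Path n) : star (φ.elt p) * φ.elt p = φ.P p.range := by
  induction n with
  | zero =>
    rw [elt, (φ.proj _).isSelfAdjoint.star_eq, (φ.proj _).isIdempotentElem.eq]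
    rfl
  | succ n ih =>
    rw [elt, star_mul, mul_assoc, ← mul_assoc (star (φ.S _)), φ.star_mul_self,
      show G.r (p.edge 0) = p.tail.source from p.r_edge 0, φ.P_source_mul_elt]
    exact ih p.tail

theorem star_elt_mul_of_ne {n : ℕ} {p q : G.Path n} (h : p ≠ q) :
    star (φ.elt p) * φ.elt q = 0 := by
  induction n with
  | zero =>
    rw [elt, elt, (φ.proj _).isSelfAdjoint.star_eq]
    exact φ.orth _ _ fun hs => h (Path.ext_source hs)
  | succ n ih =>
    rw [elt, elt, star_mul, mul_assoc, ← mul_assoc (star (φ.S _))]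
    by_cases he : p.edge 0 = q.edge 0
    · rw [he, φ.star_mul_self, show G.r (q.edge 0) = q.tail.source from q.r_edge 0,
        φ.P_source_mul_elt]
      exact ih fun ht => h (Path.ext_cons he ht)
    · rw [φ.star_mul_of_ne _ _ he, zero_mul, mul_zero]

section Sums

variable [Fintype V]

theorem S_mul_sum (e : E) : φ.S e * ∑ v, φ.P v = φ.S e := by
  rw [Finset.mul_sum, Finset.sum_eq_single (G.r e), φ.S_mul_P]
  · intro v _ hv
    rw [← φ.S_mul_P, mul_assoc, φ.orth _ _ hv.symm, mul_zero]
  · simp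

theorem sum_mul_S (e : E) : (∑ v, φ.P v) * φ.S e = φ.S e := by
  rw [Finset.sum_mul, Finset.sum_eq_single (G.s e), φ.P_mul_S]
  · intro v _ hv
    rw [← φ.P_mul_S, ← mul_assoc, φ.orth _ _ hv, zero_mul]
  · simp

theorem P_mul_sum (v : V) : φ.P v * ∑ w, φ.P w = φ.P v := by
  rw [Finset.mul_sum, Finset.sum_eq_single v, (φ.proj v).isIdempotentElem.eq]
  · intro w _ hw
    exact φ.orth _ _ hw.symm
  · simp

theorem sum_S_mul_star [Fintype E] (hG : G.NoSinks) :
    ∑ e, φ.S e * star (φ.S e) = ∑ v, φ.P v := by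
  classical
  rw [← Finset.sum_fiberwise Finset.univ G.s]
  refine Finset.sum_congr rfl fun v _ => ?_
  rw [φ.sum_range v (Set.toFinite _) (hG v)]
  refine Finset.sum_congr ?_ fun _ _ => rfl
  ext e
  simp

theorem sum_elt_mul_star [Finite E] (hG : G.NoSinks) (n : ℕ) :
    ∑ p : G.Path n, φ.elt p * star (φ.elt p) = ∑ v, φ.P v := by
  have := Fintype.ofFinite E
  induction n with
  | zero =>
    refine Fintype.sum_bijective Path.source
      ⟨fun p q h => Path.ext_source h, fun v => ⟨G.vertexPath v, rfl⟩⟩ _ _ fun p => ?_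
    · rw [elt, (φ.proj _).isSelfAdjoint.star_eq, (φ.proj _).isIdempotentElem.eq]
  | succ n ih =>
    rw [Fintype.sum_of_injective (fun p : G.Path (n + 1) => (p.edge 0, p.tail))
      (fun p q h => Path.ext_cons (Prod.ext_iff.1 h).1 (Prod.ext_iff.1 h).2) _
      (fun x : E × G.Path n => φ.S x.1 * (φ.elt x.2 * star (φ.elt x.2)) * star (φ.S x.1)),
      Fintype.sum_prod_type]
    · simp only [← Finset.mul_sum, ← Finset.sum_mul, ih, φ.S_mul_sum]
      exact φ.sum_S_mul_star hG
    · rintro ⟨e, q⟩ hx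
      have hne : G.r e ≠ q.source := fun h => hx ⟨Path.cons e q h, rfl⟩
      change φ.S e * (φ.elt q * star (φ.elt q)) * star (φ.S e) = 0
      rw [← mul_assoc, ← φ.S_mul_P, mul_assoc (φ.S e), φ.P_mul_elt_of_ne q hne]
      simp
    · intro p
      simp only [elt, star_mul, mul_assoc]

end Sums

section Perm

variable [Finite V] [Finite E] {k : ℕ} (τ : Equiv.Perm (G.Path k))

/-- The element `U_τ = ∑_{α} S_{τ(α)} S_α⋆`, the sum over all paths `α` of length `k`. -/
def permElt : A := ∑ α : G.Path k, φ.elt (τ α) * star (φ.elt α)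

variable {τ}

theorem P_mul_permElt (hτ : EndpointFixing τ) (v : V) :
    φ.P v * φ.permElt τ = φ.permElt τ * φ.P v := by
  rw [permElt, Finset.mul_sum, Finset.sum_mul]
  refine Finset.sum_congr rfl fun α _ => ?_
  have h2 : star (φ.elt α) * φ.P v = star (φ.P v * φ.elt α) := by
    rw [star_mul, (φ.proj v).isSelfAdjoint.star_eq]
  rw [mul_assoc, h2, ← mul_assoc]
  by_cases h : v = α.source
  · rw [h, φ.P_source_mul_elt, ← (hτ.apply α).1, φ.P_source_mul_elt]
  · rw [φ.P_mul_elt_of_ne α h, φ.P_mul_elt_of_ne (τ α) (by rwa [(hτ.apply α).1])]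
    simp

section

variable [Fintype V]

theorem star_permElt_mul_self (hG : G.NoSinks) (hτ : EndpointFixing τ) :
    star (φ.permElt τ) * φ.permElt τ = ∑ v, φ.P v := by
  rw [← φ.sum_elt_mul_star hG k, permElt, star_sum, Finset.sum_mul_sum]
  refine Finset.sum_congr rfl fun α _ => ?_
  rw [Finset.sum_eq_single α]
  · rw [star_mul, star_star, mul_assoc, ← mul_assoc (star (φ.elt (τ α))), φ.star_elt_mul_self,
      (hτ.apply α).2, ← mul_assoc, φ.elt_mul_P_range]
  · intro β _ hβ
    rw [star_mul, star_star, mul_assoc, ← mul_assoc (star (φ.elt (τ α))),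
      φ.star_elt_mul_of_ne (fun h => hβ (τ.injective h).symm), zero_mul, mul_zero]
  · simp

theorem permElt_mul_star_self (hG : G.NoSinks) (hτ : EndpointFixing τ) :
    φ.permElt τ * star (φ.permElt τ) = ∑ v, φ.P v := by
  rw [← φ.sum_elt_mul_star hG k, permElt, star_sum, Finset.sum_mul_sum,
    ← Equiv.sum_comp τ (fun p => φ.elt p * star (φ.elt p))]
  refine Finset.sum_congr rfl fun α _ => ?_
  rw [Finset.sum_eq_single α]
  · rw [star_mul, star_star, mul_assoc, ← mul_assoc (star (φ.elt α)), φ.star_elt_mul_self,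
      ← (hτ.apply α).2, ← mul_assoc, φ.elt_mul_P_range]
  · intro β _ hβ
    rw [star_mul, star_star, mul_assoc, ← mul_assoc (star (φ.elt α)),
      φ.star_elt_mul_of_ne hβ.symm, zero_mul, mul_zero]
  · simp

end

/-- `{P_v}`, `{U_τ S_e}` is again a family for `G`. -/
def permFamily (hG : G.NoSinks) (hτ : EndpointFixing τ) : G.Family A :=
  have := Fintype.ofFinite V
  have hU (e : E) : star (φ.permElt τ) * (φ.permElt τ * φ.S e) = φ.S e := by
    rw [← mul_assoc, φ.star_permElt_mul_self hG hτ, φ.sum_mul_S]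
  { P := φ.P
    S := fun e => φ.permElt τ * φ.S e
    proj := φ.proj
    orth := φ.orth
    partialIsometry := fun e => by
      rw [star_mul, mul_assoc, mul_assoc (star (φ.S e)), hU, φ.star_mul_self, mul_assoc, φ.S_mul_P]
    star_mul_self := fun e => by rw [star_mul, mul_assoc, hU, φ.star_mul_self]
    star_mul_of_ne := fun e f h => by rw [star_mul, mul_assoc, hU, φ.star_mul_of_ne e f h]
    range_le := fun e => by
      rw [← mul_assoc, ← mul_assoc, φ.P_mul_permElt hτ, mul_assoc (φ.permElt τ), φ.P_mul_S]
    sum_range := fun v h hne => by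
      simp only [star_mul]
      calc φ.P v = φ.P v * (φ.permElt τ * star (φ.permElt τ)) := by
            rw [φ.permElt_mul_star_self hG hτ, φ.P_mul_sum]
        _ = φ.permElt τ * φ.P v * star (φ.permElt τ) := by
            rw [← mul_assoc, φ.P_mul_permElt hτ]
        _ = _ := by
            rw [φ.sum_range v h hne, Finset.mul_sum, Finset.sum_mul]
            simp only [mul_assoc] }

end Perm

end Family

/-! ### Permutative endomorphisms -/

section Endo

variable {V E : Type u} [Finite V] [Finite E] {G : Multigraph V E} {k : ℕ}
  {τ : Equiv.Perm (G.Path k)}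

/-- The partial isometry `S_μ` in `C⋆(G)` of a path `μ`. -/
def pathElt {n : ℕ} (μ : G.Path n) : G.CStarAlg := (CStarAlg.univ G).elt μ

/-- The unitary `U_τ = ∑_α S_{τ(α)} S_α⋆` in `C⋆(G)`. -/
def permUnitary (τ : Equiv.Perm (G.Path k)) : G.CStarAlg := (CStarAlg.univ G).permElt τ

/-- The permutative endomorphism `λ_τ` of `C⋆(G)`: the ⋆-homomorphism with `λ_τ(P_v) = P_v` and
`λ_τ(S_e) = U_τ S_e`. It fixes the unit `∑_v P_v` of `C⋆(G)`. -/
def permEndo (hG : G.NoSinks) (hτ : EndpointFixing τ) : G.CStarAlg →⋆ₙₐ[ℂ] G.CStarAlg :=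
  CStarAlg.lift ((CStarAlg.univ G).permFamily hG hτ)

theorem permEndo_P (hG : G.NoSinks) (hτ : EndpointFixing τ) (v : V) :
    permEndo hG hτ (CStarAlg.P G v) = CStarAlg.P G v := CStarAlg.lift_P _ v

theorem permEndo_S (hG : G.NoSinks) (hτ : EndpointFixing τ) (e : E) :
    permEndo hG hτ (CStarAlg.S G e) = permUnitary τ * CStarAlg.S G e := CStarAlg.lift_S _ e

end Endo

/-! ### The permutation graph -/

section PermGraph

variable {V E : Type*} {G : Multigraph V E} {m : ℕ}

/-- The permutation graph of a permutation `τ` of the paths of length `k = m + 1`: its vertices are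
the paths of length `k - 1`, its edges are the paths `μ` of length `k`, the source of `μ` is
`τ(μ)₁ ⋯ τ(μ)ₖ₋₁` and the range of `μ` is `μ₂ ⋯ μₖ`. -/
def permGraph (τ : Equiv.Perm (G.Path (m + 1))) : Multigraph (G.Path m) (G.Path (m + 1)) where
  s μ := (τ μ).init
  r μ := μ.tail

variable {τ : Equiv.Perm (G.Path (m + 1))}

/-- The first label of a path `A` in the permutation graph: the path in `G` with edges
`L₁(μ) = μ₁` for the edges `μ` of `A`. It visits the sources of the vertices of `A`; in
particular a path of length `0`, i.e. a path `β` of length `k - 1` in `G`, has first label the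
vertex `s(β)`. -/
def firstLabel (hτ : EndpointFixing τ) {l : ℕ} (A : (permGraph τ).Path l) : G.Path l where
  vert i := (A.vert i).source
  edge i := (A.edge i).edge 0
  s_edge i := by
    rw [← A.s_edge i, (A.edge i).s_edge 0]
    exact (hτ.apply (A.edge i)).1.symm
  r_edge i := by
    rw [← A.r_edge i, (A.edge i).r_edge 0]
    rfl

/-- The second label of a path `A` in the permutation graph: the path in `G` with edges
`L₂(μ) = τ(μ)ₖ` for the edges `μ` of `A`. It visits the ranges of the vertices of `A`. -/
def secondLabel (hτ : EndpointFixing τ) {l : ℕ} (A : (permGraph τ).Path l) : G.Path l where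
  vert i := (A.vert i).range
  edge i := (τ (A.edge i)).edge (Fin.last m)
  s_edge i := by
    rw [← A.s_edge i, (τ (A.edge i)).s_edge (Fin.last m)]
    rfl
  r_edge i := by
    rw [← A.r_edge i, (τ (A.edge i)).r_edge (Fin.last m)]
    exact (hτ.apply (A.edge i)).2

/-- The finite set `L₁⁻¹(γ)` of all paths in the permutation graph with first label `γ`. -/
def pathsOver [Finite V] [Finite E] (hτ : EndpointFixing τ) {l : ℕ} (γ : G.Path l) :
    Finset ((permGraph τ).Path l) :=
  (Set.toFinite {A | firstLabel hτ A = γ}).toFinset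

end PermGraph

end Multigraph

end PermEnd

end

/-!
The homomorphism `λ_τ` is the lift of the family `{P_v}, {U_τ S_e}`, so it maps `S_γ` to the element
of `γ` in that family, and the formula can be proved in an arbitrary family `φ` for the graph, by
induction on the length of `γ`.

For a vertex `γ = v`, the right-hand side is the sum of `S_β S_β⋆` over the paths `β` of length `k - 1`
that start at `v`, which is `P_v` since there are no sinks (`Family.sum_elt_mul_star_source_eq`).

For `γ = e γ'`, the element of `γ` is `U_τ S_e` times that of `γ'`. A path `A'` in the permutation
graph with first label `γ'` has exactly one extension `A = μ A'` with first label `γ`, namely by the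
edge `μ = e β`, where `β` is the source of `A'` (`Path.existsUnique_tail_eq`). Since `U_τ` maps `S_μ` to
`S_{τ(μ)}` (`Family.permElt_mul_elt`), splitting the last edge off `τ(μ)` yields
`U_τ S_e S_β = S_{τ(μ)} = S_{s_τ(A)} S_{L₂(μ)}`, which turns the summand of `A'` into that of `A`.
-/

namespace PermEnd

namespace Multigraph

/-! ### Elements of paths in a family -/

namespace Family

section

variable {V E : Type*} {G : Multigraph V E} {A : Type*} [NonUnitalCStarAlgebra A] (φ : G.Family A)

theorem elt_eq_elt_init_mul {n : ℕ} (p : G.Path (n + 1)) :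
    φ.elt p = φ.elt p.init * φ.S (p.edge (Fin.last n)) := by
  induction n with
  | zero =>
    have h1 : φ.elt p = φ.S (p.edge 0) * φ.P (G.r (p.edge 0)) :=
      congrArg (fun v => φ.S (p.edge 0) * φ.P v) (p.r_edge 0).symm
    have h2 : φ.elt p.init = φ.P (G.s (p.edge 0)) := congrArg φ.P (p.s_edge 0).symm
    rw [h1, h2, φ.S_mul_P]
    exact (φ.P_mul_S _).symm
  | succ n ih =>
    rw [elt, ih p.tail, ← mul_assoc]
    rfl

variable [Finite V] [Finite E]

/-- The unitary `U_τ` implements the permutation `τ` on the elements of paths. -/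
theorem permElt_mul_elt {k : ℕ} {τ : Equiv.Perm (G.Path k)} (hτ : EndpointFixing τ)
    (α : G.Path k) : φ.permElt τ * φ.elt α = φ.elt (τ α) := by
  rw [permElt, Finset.sum_mul, Finset.sum_eq_single α]
  · rw [mul_assoc, φ.star_elt_mul_self, ← (hτ.apply α).2, φ.elt_mul_P_range]
  · intro β _ hβ
    rw [mul_assoc, φ.star_elt_mul_of_ne hβ, mul_zero]
  · simp

open Classical in
theorem sum_elt_mul_star_source_eq (hG : G.NoSinks) (n : ℕ) (v : V) :
    ∑ p : G.Path n with p.source = v, φ.elt p * star (φ.elt p) = φ.P v := by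
  have := Fintype.ofFinite V
  rw [← φ.P_mul_sum v, ← φ.sum_elt_mul_star hG n, Finset.mul_sum, Finset.sum_filter]
  refine Finset.sum_congr rfl fun p _ => ?_
  rw [← mul_assoc]
  split_ifs with h
  · rw [← h, φ.P_source_mul_elt]
  · rw [φ.P_mul_elt_of_ne p (Ne.symm h), zero_mul]

end

end Family

theorem CStarAlg.lift_pathElt {V E : Type u} {G : Multigraph V E} {A : Type u}
    [NonUnitalCStarAlgebra A] (φ : G.Family A) {n : ℕ} (p : G.Path n) :
    CStarAlg.lift φ (pathElt p) = φ.elt p := by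
  induction n with
  | zero => exact CStarAlg.lift_P φ p.source
  | succ n ih =>
    have h : pathElt p = CStarAlg.S G (p.edge 0) * pathElt p.tail := rfl
    rw [h, map_mul, CStarAlg.lift_S, ih, Family.elt]

/-! ### Labels of paths in the permutation graph -/

section Labels

variable {V E : Type*} {G : Multigraph V E} {m : ℕ} {τ : Equiv.Perm (G.Path (m + 1))}

theorem mem_pathsOver [Finite V] [Finite E] (hτ : EndpointFixing τ) {l : ℕ} {γ : G.Path l}
    {A : (permGraph τ).Path l} : A ∈ pathsOver hτ γ ↔ firstLabel hτ A = γ := by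
  simp [pathsOver]

theorem Path.source_tail_eq {l : ℕ} (A : (permGraph τ).Path (l + 1)) :
    A.tail.source = (A.edge 0).tail :=
  (A.r_edge 0).symm

/-- A path over `γ₂ ⋯ γₗ₊₁` in the permutation graph extends uniquely to a path over
`γ₁ ⋯ γₗ₊₁`, by the edge `γ₁ β`, where `β` is its source. -/
theorem Path.existsUnique_tail_eq (hτ : EndpointFixing τ) {l : ℕ} (γ : G.Path (l + 1))
    {B : (permGraph τ).Path l} (hB : firstLabel hτ B = γ.tail) :
    ∃! A : (permGraph τ).Path (l + 1), firstLabel hτ A = γ ∧ A.tail = B := by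
  have hs : G.r (γ.edge 0) = B.source.source :=
    (γ.r_edge 0).trans (congrArg Path.source hB).symm
  refine ⟨Path.cons (Path.cons (γ.edge 0) B.source hs) B rfl,
    ⟨Path.ext_cons rfl hB, rfl⟩, ?_⟩
  rintro A ⟨hA, rfl⟩
  refine Path.ext_cons (Path.ext_cons ?_ A.source_tail_eq.symm) rfl
  exact congrFun (congrArg Path.edge hA) 0

end Labels

/-! ### The permuted family -/

section PermFamily

variable {V E : Type*} [Finite V] [Finite E] {G : Multigraph V E} {A : Type*}
  [NonUnitalCStarAlgebra A] {m : ℕ} {τ : Equiv.Perm (G.Path (m + 1))}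

/-- The identity `U_τ S_e S_β = S_{τ(μ)₁ ⋯ τ(μ)ₖ₋₁} S_{τ(μ)ₖ}` for `μ = e β`. -/
theorem Family.permElt_mul_S_mul_elt (φ : G.Family A) (hτ : EndpointFixing τ)
    (μ : G.Path (m + 1)) :
    φ.permElt τ * φ.S (μ.edge 0) * φ.elt μ.tail =
      φ.elt (τ μ).init * φ.S ((τ μ).edge (Fin.last m)) := by
  rw [mul_assoc, ← φ.elt_eq_elt_init_mul, ← φ.permElt_mul_elt hτ, Family.elt]

theorem Family.elt_permFamily (φ : G.Family A) (hG : G.NoSinks) (hτ : EndpointFixing τ) {l : ℕ}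
    (γ : G.Path l) :
    (φ.permFamily hG hτ).elt γ = ∑ B ∈ pathsOver hτ γ,
      φ.elt B.source * φ.elt (secondLabel hτ B) * star (φ.elt B.range) := by
  classical
  induction l with
  | zero =>
    have h : (φ.permFamily hG hτ).elt γ = φ.P γ.source := rfl
    rw [h, ← φ.sum_elt_mul_star_source_eq hG m γ.source]
    -- The paths of length `0` in the permutation graph are the paths of length `k - 1` in `G`.
    refine (Finset.sum_nbij Path.source ?_ ?_ ?_ ?_).symm
    · intro B hB
      rw [mem_pathsOver] at hB
      simp only [Finset.mem_filter, Finset.mem_univ, true_and]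
      exact congrArg Path.source hB
    · exact fun B _ C _ h => Path.ext_source h
    · intro β hβ
      simp only [Finset.coe_filter, Finset.mem_univ, true_and, Set.mem_ofPred_eq] at hβ
      exact ⟨(permGraph τ).vertexPath β, (mem_pathsOver hτ).2 (Path.ext_source hβ), rfl⟩
    · intro B _
      exact congrArg (· * star (φ.elt B.source)) (φ.elt_mul_P_range B.source)
  | succ l ih =>
    have h : (φ.permFamily hG hτ).elt γ =
        φ.permElt τ * φ.S (γ.edge 0) * (φ.permFamily hG hτ).elt γ.tail := rfl
    rw [h, ih, Finset.mul_sum]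
    have htail {B : (permGraph τ).Path (l + 1)} (hB : B ∈ pathsOver hτ γ) :
        firstLabel hτ B.tail = γ.tail :=
      congrArg Path.tail ((mem_pathsOver hτ).1 hB)
    refine (Finset.sum_nbij Path.tail ?_ ?_ ?_ ?_).symm
    · exact fun B hB => (mem_pathsOver hτ).2 (htail hB)
    · intro B hB C hC hBC
      exact (Path.existsUnique_tail_eq hτ γ (htail hB)).unique
        ⟨(mem_pathsOver hτ).1 hB, rfl⟩ ⟨(mem_pathsOver hτ).1 hC, hBC.symm⟩
    · intro B hB
      obtain ⟨C, ⟨hC, hCB⟩, -⟩ := Path.existsUnique_tail_eq hτ γ ((mem_pathsOver hτ).1 hB)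
      exact ⟨C, (mem_pathsOver hτ).2 hC, hCB⟩
    · intro B hB
      have he : γ.edge 0 = (B.edge 0).edge 0 :=
        (congrFun (congrArg Path.edge ((mem_pathsOver hτ).1 hB)) 0).symm
      have hs : B.source = (τ (B.edge 0)).init := (B.s_edge 0).symm
      have hl : φ.elt (secondLabel hτ B) =
          φ.S ((τ (B.edge 0)).edge (Fin.last m)) * φ.elt (secondLabel hτ B.tail) := rfl
      have hr : B.range = B.tail.range := rfl
      rw [he, B.source_tail_eq, ← mul_assoc, ← mul_assoc, φ.permElt_mul_S_mul_elt hτ, hs, hl, hr,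
        ← mul_assoc]

end PermFamily

end Multigraph

end PermEnd

theorem mainTheorem7 {V E : Type u} [Finite V] [Finite E] (G : PermEnd.Multigraph V E)
    (hG : G.NoSinks) {m : ℕ} (τ : Equiv.Perm (G.Path (m + 1)))
    (hτ : PermEnd.Multigraph.EndpointFixing τ) {l : ℕ} (γ : G.Path l) :
    PermEnd.Multigraph.permEndo hG hτ (PermEnd.Multigraph.pathElt γ) =
      ∑ A ∈ PermEnd.Multigraph.pathsOver hτ γ,
        PermEnd.Multigraph.pathElt A.source *
          PermEnd.Multigraph.pathElt (PermEnd.Multigraph.secondLabel hτ A) *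
            star (PermEnd.Multigraph.pathElt A.range) :=
  (PermEnd.Multigraph.CStarAlg.lift_pathElt _ γ).trans
    ((PermEnd.Multigraph.CStarAlg.univ G).elt_permFamily hG hτ γ)
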